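/- An instance of the robust representative selection problem with locally budgeted uncertainty consists of items $[n]$, a partition $[n]=P_1\cup\dots\cup P_K$ into nonempty regions, a partition $[n]=T_1\cup\dots\cup T_L$ into nonempty parts, numbers $p_\ell\in\mathbb{N}$ for $\ell\in[L]$, and nonnegative integers $\underline c_i, d_i$ ($i\in[n]$) and $\Gamma_j$ ($j\in[K]$). Let $$\mathcal X=\Big\{x\in\{0,1\}^n : \sum_{i\in T_\ell}x_i=p_\ell\ \ \forall \ell\in[L]\Big\},$$ $$\mathcal U=\Big\{\underline c+\delta : \delta\in\mathbb{R}^n,\ 0\le\delta_i\le d_i\ \ \forall i\in[n],\ \sum_{i\in P_j}\delta_i\le\Gamma_j\ \ \forall j\in[K]\Big\}.$$ The problem is $\min_{x\in\mathcal X}\max_{c\in\mathcal U}c^{t}x$; in its decision version a threshold $k\in\mathbb{N}$ is also given, and one asks whether there is an $x\in\mathcal X$ with $\max_{c\in\mathcal U}c^tx\le k$. Running times are numbers of steps of multi-tape Turing machines (in the form of deterministic programs on finitely many stacks over a finite alphabet); sizes and indices in the input are written in unary, the numbers $\underline c_i,d_i,\Gamma_j,p_\ell,k$ in binary. $O^*$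 suppresses factors that are polynomial in the length of the input. The Exponential Time Hypothesis (ETH) says that there is a $\delta>0$ such that no algorithm decides 3-SAT in time $O^*(2^{\delta \tilde n})$, where $\tilde n$ is the number of variables of the formula. **Theorem.** Assume ETH. Then there is no algorithm that decides the robust representative selection problem with locally budgeted uncertainty in time $O^*(2^{f(K)})$ for some function $f:\mathbb{N}\to\mathbb{R}$ with $f(K)=o(K)$. This holds even if the algorithm is required to be correct and to keep the time bound only on the instances with $|T_\ell|\le 3$ and $p_\ell=1$ for all $\ell\in[L]$. -/

import Mathlib

namespace LocBudget

open scoped BigOperators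

/-! ### Machine model: deterministic programs on finitely many stacks, with a step count -/

/-- The work alphabet: two bits and a separator. -/
inductive Letter where
  | zero
  | one
  | sep
  deriving DecidableEq

/-- Deterministic programs that operate on stacks of letters. The stacks are numbered by natural
numbers; a program mentions only finitely many of them. This is the multi-tape Turing machine in
structured form: a tape is a pair of stacks, and the finite control is kept on a further stack.
The two models simulate each other with a constant factor overhead in time. -/
inductive Prog where
  /-- do nothing -/
  | skip : Prog
  /-- push the letter `a` on stack `r` -/
  | push (r : ℕ) (a : Letter) : Prog
  /-- remove the top letter of stack `r` (no effect on the empty stack) -/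
  | pop (r : ℕ) : Prog
  /-- sequential composition -/
  | seq (P Q : Prog) : Prog
  /-- if the top of stack `r` is `o` (where `none` means that the stack is empty)
  then run `P`, else run `Q` -/
  | ite (r : ℕ) (o : Option Letter) (P Q : Prog) : Prog
  /-- repeat `P` until the top of stack `r` is `o`; the test comes before the body -/
  | loop (r : ℕ) (o : Option Letter) (P : Prog) : Prog

/-- The contents of the stacks, top letter first. -/
abbrev Store := ℕ → List Letter

/-- `Exec P s t s'`: started in `s`, the program `P` halts after exactly `t` steps in `s'`.
Every elementary instruction and every evaluation of a test is one step. -/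
inductive Exec : Prog → Store → ℕ → Store → Prop where
  | skip (s : Store) : Exec Prog.skip s 1 s
  | push (r : ℕ) (a : Letter) (s : Store) :
      Exec (Prog.push r a) s 1 (Function.update s r (a :: s r))
  | pop (r : ℕ) (s : Store) :
      Exec (Prog.pop r) s 1 (Function.update s r (s r).tail)
  | seq {P Q : Prog} {s s' s'' : Store} {t t' : ℕ} :
      Exec P s t s' → Exec Q s' t' s'' → Exec (Prog.seq P Q) s (t + t') s''
  | ite_pos {r : ℕ} {o : Option Letter} {P Q : Prog} {s s' : Store} {t : ℕ} :
      (s r).head? = o → Exec P s t s' → Exec (Prog.ite r o P Q) s (t + 1) s'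
  | ite_neg {r : ℕ} {o : Option Letter} {P Q : Prog} {s s' : Store} {t : ℕ} :
      (s r).head? ≠ o → Exec Q s t s' → Exec (Prog.ite r o P Q) s (t + 1) s'
  | loop_done {r : ℕ} {o : Option Letter} {P : Prog} {s : Store} :
      (s r).head? = o → Exec (Prog.loop r o P) s 1 s
  | loop_step {r : ℕ} {o : Option Letter} {P : Prog} {s s' s'' : Store} {t t' : ℕ} :
      (s r).head? ≠ o → Exec P s t s' → Exec (Prog.loop r o P) s' t' s'' →
      Exec (Prog.loop r o P) s (t + t' + 1) s''

/-- The initial store: the input word on stack `0`, all other stacks empty. -/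
def initStore (w : List Letter) : Store := Function.update (fun _ => []) 0 w

/-- The program `P` decides the problem with instances `x ∈ dom`, encoding `enc` and yes-instances
`yes`, within at most `B x` steps on the instance `x`. The answer is read off from stack `0`:
it is "yes" if and only if the top letter is `one`. Nothing is required outside `dom`. -/
def Decides {α : Type*} (P : Prog) (dom : Set α) (enc : α → List Letter) (yes : α → Prop)
    (B : α → ℝ) : Prop :=
  ∀ x ∈ dom, ∃ (t : ℕ) (s : Store), Exec P (initStore (enc x)) t s ∧ (t : ℝ) ≤ B x ∧
    ((s 0).head? = some Letter.one ↔ yes x)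

/-- Some program decides the problem in time `O*(2 ^ f(κ))`, i.e. in at most `q(N) * 2 ^ f(κ x)`
steps, where `q` is a polynomial, `N` is the length of the encoded instance and `κ` is the
parameter. -/
def DecidableInTimeStar {α : Type*} (dom : Set α) (enc : α → List Letter) (yes : α → Prop)
    (κ : α → ℕ) (f : ℕ → ℝ) : Prop :=
  ∃ (P : Prog) (q : Polynomial ℕ),
    Decides P dom enc yes fun x => ((q.eval (enc x).length : ℕ) : ℝ) * (2 : ℝ) ^ f (κ x)

/-! ### Encoding of numbers -/

/-- Unary code, closed by a separator. Used for sizes and indices. -/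
def unary (k : ℕ) : List Letter := List.replicate k Letter.one ++ [Letter.sep]

/-- The letter of a bit. -/
def bitLetter (b : Bool) : Letter := if b then Letter.one else Letter.zero

/-- Binary code (least significant bit first), closed by a separator. Used for numerical data. -/
def binary (k : ℕ) : List Letter := k.bits.map bitLetter ++ [Letter.sep]

/-! ### 3-SAT and the exponential time hypothesis -/

/-- A formula in 3-CNF with the variables `0, …, n - 1`. A clause is a triple of literals; the
literal `(i, true)` is the variable `i`, and `(i, false)` is its negation. -/
structure ThreeCNF where
  n : ℕ
  clauses : List (Fin 3 → Fin n × Bool)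

/-- Some truth assignment makes at least one literal of every clause true. -/
def ThreeCNF.Satisfiable (φ : ThreeCNF) : Prop :=
  ∃ a : Fin φ.n → Bool, ∀ C ∈ φ.clauses, ∃ j : Fin 3, a (C j).1 = (C j).2

/-- The number of variables, followed by the literals of all clauses: sign and index each. -/
def ThreeCNF.encode (φ : ThreeCNF) : List Letter :=
  unary φ.n ++ φ.clauses.flatMap fun C =>
    (List.finRange 3).flatMap fun j => bitLetter (C j).2 :: unary ((C j).1 : ℕ)

/-- The exponential time hypothesis: for some `δ > 0` there is no algorithm that decides 3-SAT in
time `O*(2 ^ (δ n))`, where `n` is the number of variables. -/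
def ExponentialTimeHypothesis : Prop :=
  ∃ δ : ℝ, 0 < δ ∧
    ¬ DecidableInTimeStar Set.univ ThreeCNF.encode ThreeCNF.Satisfiable ThreeCNF.n
      (fun n => δ * (n : ℝ))

/-! ### Robust representative selection with locally budgeted uncertainty -/

/-- An instance: `n` items, partitioned into the `K` regions `region ⁻¹ j` and also into the `L`
parts `part ⁻¹ l` (the blocks of both partitions are nonempty), the numbers `p l` of items to be
selected from the parts, lower bounds `c i` of the costs, maximum deviations `d i`, and the budgets
`Γ j` of the regions. -/
structure RepSelInstance where
  n : ℕ
  K : ℕ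
  L : ℕ
  region : Fin n → Fin K
  region_surjective : Function.Surjective region
  part : Fin n → Fin L
  part_surjective : Function.Surjective part
  p : Fin L → ℕ
  c : Fin n → ℕ
  d : Fin n → ℕ
  Γ : Fin K → ℕ

namespace RepSelInstance

/-- The region `P_j`. -/
def regionSet (I : RepSelInstance) (j : Fin I.K) : Finset (Fin I.n) :=
  Finset.univ.filter fun i => I.region i = j

/-- The part `T_l`. -/
def partSet (I : RepSelInstance) (l : Fin I.L) : Finset (Fin I.n) :=
  Finset.univ.filter fun i => I.part i = l

/-- The feasible solutions: 0-1 vectors that select exactly `p l` items from every part. -/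
def feasible (I : RepSelInstance) : Set (Fin I.n → ℝ) :=
  {x | (∀ i, x i = 0 ∨ x i = 1) ∧ ∀ l, ∑ i ∈ I.partSet l, x i = (I.p l : ℝ)}

/-- The locally budgeted uncertainty set. -/
def uncertaintySet (I : RepSelInstance) : Set (Fin I.n → ℝ) :=
  {cost | ∃ δ : Fin I.n → ℝ, (∀ i, cost i = (I.c i : ℝ) + δ i) ∧
    (∀ i, 0 ≤ δ i ∧ δ i ≤ (I.d i : ℝ)) ∧ ∀ j, ∑ i ∈ I.regionSet j, δ i ≤ (I.Γ j : ℝ)}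

/-- The worst-case cost of `x`: the maximum of the cost over all scenarios. (The set is nonempty,
compact, so that the supremum is a maximum.) -/
noncomputable def robustCost (I : RepSelInstance) (x : Fin I.n → ℝ) : ℝ :=
  sSup ((fun cost : Fin I.n → ℝ => ∑ i, cost i * x i) '' I.uncertaintySet)

/-- Sizes; then region, part, lower cost bound and deviation of every item; then the budgets of
the regions, the numbers `p l`, and the threshold `k`. -/
def encode (I : RepSelInstance) (k : ℕ) : List Letter :=
  unary I.n ++ unary I.K ++ unary I.L ++
    ((List.finRange I.n).flatMap fun i =>
      unary (I.region i : ℕ) ++ unary (I.part i : ℕ) ++ binary (I.c i) ++ binary (I.d i)) ++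
    ((List.finRange I.K).flatMap fun j => binary (I.Γ j)) ++
    ((List.finRange I.L).flatMap fun l => binary (I.p l)) ++
    binary k

/-- The decision version of the min-max problem for the instance `I` and the threshold `k`:
is there a feasible solution with worst-case cost at most `k`? -/
def HasRobustCostAtMost (I : RepSelInstance) (k : ℕ) : Prop :=
  ∃ x ∈ I.feasible, I.robustCost x ≤ (k : ℝ)

end RepSelInstance

end LocBudget

namespace LocBudget

open Letter

/-! ### Execution with a time bound -/

/-! 3-SAT with `n` variables reduces in polynomial time to the selection problem with `K = 2n`
regions, one per literal, so an algorithm with exponent `o(K)` would decide 3-SAT with exponent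
`o(n)`.

Each variable gives a part holding its two literals, and each clause a part holding its three
literals; one item is selected per part. Lower bounds are zero, a literal of variable `v` has budget
`2 ^ v`, and every deviation `2 ^ n - 1` is at least any budget. The adversary can therefore collect
the full budget of every region containing a selected item, and nothing elsewhere. The variable
parts force at least one used literal per variable, so the worst case costs at least `∑ 2 ^ v = 2 ^
n - 1`. It stays within this threshold exactly when no variable has both literals used
(`not_and_of_sum_le`, which needs only positive weights). The used literals then define an
assignment, and the clause parts show that it satisfies the formula. This is
`hasRobustCostAtMost_iff_satisfiable`.

The rest is the machine: `runs_reduction` bounds the running time of the reduction, and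
`encode_toRepSel` identifies its output. Stack 0 is input and output, 1 is scratch, 2 holds `n`, 3
the current part index, 4 the number of items, 5 and 6 the reversed codes of items and budgets, 7
the variables still to be treated. -/

/-- The program `P` takes the store `s` to `s'` in at most `T` steps. -/
def Runs (P : Prog) (s s' : Store) (T : ℕ) : Prop := ∃ t ≤ T, Exec P s t s'

theorem Runs.mono {P : Prog} {s s' : Store} {T T' : ℕ} (h : Runs P s s' T) (hT : T ≤ T') :
    Runs P s s' T' := by
  obtain ⟨t, ht, h⟩ := h
  exact ⟨t, ht.trans hT, h⟩

theorem Runs.congr {P : Prog} {s s' s'' : Store} {T : ℕ} (h : Runs P s s' T) (e : s' = s'') :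
    Runs P s s'' T := e ▸ h

theorem Runs.congr_left {P : Prog} {s s' s'' : Store} {T : ℕ} (h : Runs P s s' T) (e : s = s'') :
    Runs P s'' s' T := e ▸ h

theorem Runs.seq {P Q : Prog} {s s' s'' : Store} {T T' : ℕ} (h : Runs P s s' T)
    (h' : Runs Q s' s'' T') : Runs (Prog.seq P Q) s s'' (T + T') := by
  obtain ⟨t, ht, h⟩ := h
  obtain ⟨t', ht', h'⟩ := h'
  exact ⟨t + t', by omega, Exec.seq h h'⟩

theorem Runs.push (r : ℕ) (a : Letter) (s : Store) :
    Runs (Prog.push r a) s (Function.update s r (a :: s r)) 1 := ⟨1, le_rfl, Exec.push r a s⟩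

theorem Runs.pop (r : ℕ) (s : Store) :
    Runs (Prog.pop r) s (Function.update s r (s r).tail) 1 := ⟨1, le_rfl, Exec.pop r s⟩

theorem Runs.skip (s : Store) : Runs Prog.skip s s 1 := ⟨1, le_rfl, Exec.skip s⟩

theorem Runs.ite_pos {r : ℕ} {o : Option Letter} {P Q : Prog} {s s' : Store} {T : ℕ}
    (ho : (s r).head? = o) (h : Runs P s s' T) : Runs (Prog.ite r o P Q) s s' (T + 1) := by
  obtain ⟨t, ht, h⟩ := h
  exact ⟨t + 1, by omega, Exec.ite_pos ho h⟩

theorem Runs.ite_neg {r : ℕ} {o : Option Letter} {P Q : Prog} {s s' : Store} {T : ℕ}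
    (ho : (s r).head? ≠ o) (h : Runs Q s s' T) : Runs (Prog.ite r o P Q) s s' (T + 1) := by
  obtain ⟨t, ht, h⟩ := h
  exact ⟨t + 1, by omega, Exec.ite_neg ho h⟩

theorem Runs.loop_done {r : ℕ} {o : Option Letter} {P : Prog} {s : Store}
    (ho : (s r).head? = o) : Runs (Prog.loop r o P) s s 1 := ⟨1, le_rfl, Exec.loop_done ho⟩

theorem Runs.loop_step {r : ℕ} {o : Option Letter} {P : Prog} {s s' s'' : Store} {T T' : ℕ}
    (ho : (s r).head? ≠ o) (h : Runs P s s' T) (h' : Runs (Prog.loop r o P) s' s'' T') :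
    Runs (Prog.loop r o P) s s'' (T + T' + 1) := by
  obtain ⟨t, ht, h⟩ := h
  obtain ⟨t', ht', h'⟩ := h'
  exact ⟨t + t' + 1, by omega, Exec.loop_step ho h h'⟩

/-- A loop whose intermediate stores are known. -/
theorem Runs.loop {r : ℕ} {o : Option Letter} {P : Prog} {T : ℕ} (k : ℕ) (f : ℕ → Store)
    (hne : ∀ i < k, (f i r).head? ≠ o) (hk : (f k r).head? = o)
    (hP : ∀ i < k, Runs P (f i) (f (i + 1)) T) :
    Runs (Prog.loop r o P) (f 0) (f k) (k * (T + 1) + 1) := by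
  induction k generalizing f with
  | zero => simpa using Runs.loop_done hk
  | succ k ih =>
    have := ih (fun i => f (i + 1)) (fun i hi => hne _ (by omega)) hk
      (fun i hi => hP _ (by omega))
    refine (Runs.loop_step (hne 0 (by omega)) (hP 0 (by omega)) this).mono ?_
    apply le_of_eq
    ring

/-- A run lengthens each stack by at most the number of steps. -/
theorem Exec.length_le {P : Prog} {s s' : Store} {t : ℕ} (h : Exec P s t s') (r : ℕ) :
    (s' r).length ≤ (s r).length + t := by
  induction h with
  | skip s => omega
  | push q a s =>
    rcases eq_or_ne r q with rfl | hr
    · simp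
    · simp [Function.update_of_ne hr]
  | pop q s =>
    rcases eq_or_ne r q with rfl | hr
    · simp; omega
    · simp [Function.update_of_ne hr]
  | seq _ _ ih ih' => omega
  | ite_pos _ _ ih => omega
  | ite_neg _ _ ih => omega
  | loop_done _ => omega
  | loop_step _ _ _ ih ih' => omega

theorem Runs.length_le {P : Prog} {s s' : Store} {T : ℕ} (h : Runs P s s' T) (r : ℕ) :
    (s' r).length ≤ (s r).length + T := by
  obtain ⟨t, ht, h⟩ := h
  exact (h.length_le r).trans (by omega)

/-! ### Compound programs -/

/-- The sequential composition of a list of programs. -/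
def block : List Prog → Prog
  | [] => Prog.skip
  | P :: Ps => Prog.seq P (block Ps)

theorem Runs.nil {s s' : Store} (h : s = s') : Runs (block []) s s' 1 := h ▸ Runs.skip s

theorem Runs.cons {P : Prog} {Ps : List Prog} {s s' s'' : Store} {T T' : ℕ} (h : Runs P s s' T)
    (h' : Runs (block Ps) s' s'' T') : Runs (block (P :: Ps)) s s'' (T + T') := h.seq h'

/-- Push the letters of the word `w` on the stack `r`, one after the other. -/
def pushWord (r : ℕ) (w : List Letter) : Prog := block (w.map (Prog.push r))

theorem runs_pushWord (r : ℕ) (w : List Letter) (s : Store) :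
    Runs (pushWord r w) s (Function.update s r (w.reverse ++ s r)) (w.length + 1) := by
  induction w generalizing s with
  | nil => exact Runs.nil (by simp)
  | cons a w ih =>
    refine (Runs.cons (Runs.push r a s) ((ih _).congr ?_)).mono ?_
    · simp
    · simp; omega

/-- Empty the stack `a`, pushing the word `w` on `b` for every letter removed. -/
def drain (a : ℕ) (w : List Letter) (b : ℕ) : Prog :=
  Prog.loop a none (block [Prog.pop a, pushWord b w])

theorem flatten_replicate_succ' {α : Type*} (k : ℕ) (w : List α) :
    (List.replicate (k + 1) w).flatten = w ++ (List.replicate k w).flatten := by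
  simp [List.replicate_succ]

theorem runs_drain {a b : ℕ} (hab : b ≠ a) (w : List Letter) (s : Store) :
    Runs (drain a w b) s
      (Function.update (Function.update s a []) b
        ((List.replicate (s a).length w.reverse).flatten ++ s b))
      ((s a).length * (w.length + 4) + 1) := by
  generalize hl : s a = l
  induction l generalizing s with
  | nil =>
    refine (Runs.loop_done (by simp [hl])).congr ?_ |>.mono (by omega)
    funext i
    by_cases hb : i = b
    · subst hb; simp
    · by_cases ha : i = a
      · subst ha; simp [hb, hl]
      · simp [ha, hb]
  | cons x l ih =>
    have h1 := Runs.cons (Runs.pop a s) (Runs.cons (runs_pushWord b w _) (Runs.nil rfl))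
    refine (Runs.loop_step (by simp [hl]) h1 ((ih _ ?_).congr ?_)).mono ?_
    · simp [hl, hab.symm]
    · funext i
      by_cases hb : i = b
      · subst hb
        -- The word pushed in this round lies below all later ones, so the single copy is split off
        -- at the end.
        have := (List.replicate_append_replicate (n := l.length) (m := 1) (a := w.reverse)).symm
        simp [this, hab]
      · by_cases ha : i = a
        · subst ha; simp [hb]
        · simp [ha, hb]
    · simp only [List.length_cons]
      apply le_of_eq
      ring

/-- Push the word `w` on the stack `b` for every letter on the stack `a`; the stack `1` is used
as an auxiliary stack. -/
def copy (a : ℕ) (w : List Letter) (b : ℕ) : Prog :=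
  Prog.seq (Prog.loop a none (block [Prog.pop a, Prog.push 1 one, pushWord b w])) (drain 1 [one] a)

/-- Reading a stack destroys it, so every letter is parked on stack `1` and the final `drain`
restores it. That `drain` writes only `one`, hence the requirement that `a` be a unary counter. -/
theorem runs_copy {a b k : ℕ} (w : List Letter) (s : Store) (ha : s a = List.replicate k one)
    (h1 : s 1 = []) (hab : b ≠ a) (ha1 : a ≠ 1) (hb1 : b ≠ 1) :
    Runs (copy a w b) s
      (Function.update s b ((List.replicate k w.reverse).flatten ++ s b))
      (k * (w.length + 10) + 2) := by
  have key := Runs.loop (r := a) (o := none)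
    (P := block [Prog.pop a, Prog.push 1 one, pushWord b w]) (T := w.length + 4) k
    (fun i => Function.update (Function.update (Function.update s a
      (List.replicate (k - i) one)) 1 (List.replicate i one)) b
        ((List.replicate i w.reverse).flatten ++ s b))
    (fun i hi => by
      have : k - i ≠ 0 := by omega
      simp [hab.symm, ha1, this])
    (by simp [hab.symm, ha1])
    (fun i hi => by
      refine (Runs.cons (Runs.pop a _) (Runs.cons (Runs.push 1 one _)
        (Runs.cons (runs_pushWord b w _) (Runs.nil ?_)))).mono (by omega)
      funext j
      by_cases hjb : j = b
      · subst hjb; simp [hab, hb1, flatten_replicate_succ']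
      · by_cases hj1 : j = 1
        · subst hj1; simp [hb1.symm, ha1.symm, List.replicate_succ]
        · by_cases hja : j = a
          · subst hja; simp [hj1, hjb, Nat.sub_sub]
          · simp [hja, hj1, hjb])
  refine (((key.congr_left ?_).seq (runs_drain ha1 [one] _)).congr ?_).mono ?_
  · funext j
    by_cases hjb : j = b
    · subst hjb; simp
    · by_cases hj1 : j = 1
      · subst hj1; simp [h1, hb1.symm]
      · by_cases hja : j = a
        · subst hja; simp [hj1, hjb, ha]
        · simp [hja, hj1, hjb]
  · funext j
    by_cases hjb : j = b
    · subst hjb; simp [hab, hb1]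
    · by_cases hj1 : j = 1
      · subst hj1; simp [h1, ha1.symm, hb1.symm]
      · by_cases hja : j = a
        · subst hja; simp [hj1, hjb, ha, hb1.symm]
        · simp [hja, hj1, hjb]
  · simp [hb1.symm]
    apply le_of_eq
    ring

/-- Move the letters of the stack `a` to the stack `b` one by one. -/
def move (a b : ℕ) : Prog :=
  Prog.loop a none
    (Prog.ite a (some one) (block [Prog.pop a, Prog.push b one])
      (Prog.ite a (some zero) (block [Prog.pop a, Prog.push b zero])
        (block [Prog.pop a, Prog.push b sep])))

theorem runs_move {a b : ℕ} (hab : b ≠ a) (s : Store) :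
    Runs (move a b) s
      (Function.update (Function.update s a []) b ((s a).reverse ++ s b))
      ((s a).length * 6 + 1) := by
  generalize hl : s a = l
  induction l generalizing s with
  | nil =>
    refine (Runs.loop_done (by simp [hl])).congr ?_ |>.mono (by omega)
    funext i
    by_cases hb : i = b
    · subst hb; simp
    · by_cases ha : i = a
      · subst ha; simp [hb, hl]
      · simp [ha, hb]
  | cons x l ih =>
    have h1 : Runs (block [Prog.pop a, Prog.push b x]) s _ _ :=
      Runs.cons (Runs.pop a s) (Runs.cons (Runs.push b x _) (Runs.nil rfl))
    have h2 := ih _ (by simp [hl, hab.symm] :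
      Function.update (Function.update s a (s a).tail) b
        (x :: Function.update s a (s a).tail b) a = l)
    -- A push has a fixed letter, so the letter must first be identified: at most two tests, then
    -- three steps for the block.
    refine (Runs.loop_step (T := 5) (by simp [hl]) ?_ (h2.congr ?_)).mono ?_
    · cases x with
      | one => exact (Runs.ite_pos (by simp [hl]) h1).mono (by omega)
      | zero =>
        exact (Runs.ite_neg (by simp [hl]) (Runs.ite_pos (by simp [hl]) h1)).mono (by omega)
      | sep =>
        exact (Runs.ite_neg (by simp [hl]) (Runs.ite_neg (by simp [hl]) h1)).mono (by omega)
    · funext i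
      by_cases hb : i = b
      · subst hb; simp [hab]
      · by_cases ha : i = a
        · subst ha; simp [hb]
        · simp [ha, hb]
    · simp only [List.length_cons]
      omega

/-! ### The reduction as a program -/

/-- The store with the given contents of the stacks `0, …, 7`, the others being empty. -/
def store (a b c d e f g h : List Letter) : Store
  | 0 => a
  | 1 => b
  | 2 => c
  | 3 => d
  | 4 => e
  | 5 => f
  | 6 => g
  | 7 => h
  | _ => []

section Stacks

variable (a b c d e f g h x : List Letter)

@[simp] theorem store_zero : store a b c d e f g h 0 = a := rfl
@[simp] theorem store_one : store a b c d e f g h 1 = b := rfl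
@[simp] theorem store_two : store a b c d e f g h 2 = c := rfl
@[simp] theorem store_three : store a b c d e f g h 3 = d := rfl
@[simp] theorem store_four : store a b c d e f g h 4 = e := rfl
@[simp] theorem store_five : store a b c d e f g h 5 = f := rfl
@[simp] theorem store_six : store a b c d e f g h 6 = g := rfl
@[simp] theorem store_seven : store a b c d e f g h 7 = h := rfl

@[simp] theorem update_store_zero :
    Function.update (store a b c d e f g h) 0 x = store x b c d e f g h := by
  funext i; rcases i with _ | _ | _ | _ | _ | _ | _ | _ | i <;> rfl
@[simp] theorem update_store_two :
    Function.update (store a b c d e f g h) 2 x = store a b x d e f g h := by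
  funext i; rcases i with _ | _ | _ | _ | _ | _ | _ | _ | i <;> rfl
@[simp] theorem update_store_three :
    Function.update (store a b c d e f g h) 3 x = store a b c x e f g h := by
  funext i; rcases i with _ | _ | _ | _ | _ | _ | _ | _ | i <;> rfl
@[simp] theorem update_store_four :
    Function.update (store a b c d e f g h) 4 x = store a b c d x f g h := by
  funext i; rcases i with _ | _ | _ | _ | _ | _ | _ | _ | i <;> rfl
@[simp] theorem update_store_five :
    Function.update (store a b c d e f g h) 5 x = store a b c d e x g h := by
  funext i; rcases i with _ | _ | _ | _ | _ | _ | _ | _ | i <;> rfl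
@[simp] theorem update_store_six :
    Function.update (store a b c d e f g h) 6 x = store a b c d e f x h := by
  funext i; rcases i with _ | _ | _ | _ | _ | _ | _ | _ | i <;> rfl
@[simp] theorem update_store_seven :
    Function.update (store a b c d e f g h) 7 x = store a b c d e f g x := by
  funext i; rcases i with _ | _ | _ | _ | _ | _ | _ | _ | i <;> rfl

theorem initStore_eq_store : initStore a = store a [] [] [] [] [] [] [] := by
  funext i; rcases i with _ | _ | _ | _ | _ | _ | _ | _ | i <;> rfl

end Stacks

/-- A word of `k` ones. -/
abbrev ones (k : ℕ) : List Letter := List.replicate k one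

theorem flatten_replicate_pair {α : Type*} (k : ℕ) (a : α) :
    (List.replicate k [a, a]).flatten = List.replicate (k * 2) a := by
  induction k with
  | zero => rfl
  | succ k ih => simp [List.replicate_succ, ih, Nat.succ_mul]

theorem reverse_unary (k : ℕ) : (unary k).reverse = sep :: ones k := by simp [unary]

/-- The code of an item with region `r`, part `p`, lower bound `0` and deviation `2 ^ n - 1`. -/
def itemWord (n r p : ℕ) : List Letter :=
  unary r ++ unary p ++ [sep] ++ (ones n ++ [sep])

/-- Append the part index (stack `3`) and the cost data of an item to the stack `5`. -/
def emitCosts : Prog :=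
  block [copy 3 [one] 5, Prog.push 5 sep, Prog.push 5 sep, copy 2 [one] 5, Prog.push 5 sep,
    Prog.push 4 one]

/-- Of the two consecutive separators, the first closes the part index and the second is the entire
binary code of the lower bound `0`. The last push counts the item. -/
theorem runs_emitCosts (a o G h : List Letter) (n p N M : ℕ) (hn : n ≤ M) (hp : p ≤ M) :
    Runs emitCosts (store a [] (ones n) (ones p) (ones N) o G h)
      (store a [] (ones n) (ones p) (ones (N + 1))
        ((unary p ++ [sep] ++ (ones n ++ [sep])).reverse ++ o) G h) (22 * M + 9) := by
  refine (Runs.cons ((runs_copy (k := p) _ _ ?_ ?_ ?_ ?_ ?_).congr (update_store_five ..)) <|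
    Runs.cons ((Runs.push ..).congr (update_store_five ..)) <|
    Runs.cons ((Runs.push ..).congr (update_store_five ..)) <|
    Runs.cons ((runs_copy (k := n) _ _ ?_ ?_ ?_ ?_ ?_).congr (update_store_five ..)) <|
    Runs.cons ((Runs.push ..).congr (update_store_five ..)) <|
    Runs.cons ((Runs.push ..).congr (update_store_four ..)) <|
    Runs.nil ?_).mono ?_
  all_goals first | rfl | simp [unary, List.replicate_succ]
  omega

/-- Read a literal and append the corresponding item to the stack `5`. -/
def emitLiteral : Prog :=
  block [Prog.ite 0 (some one) (Prog.push 5 one) Prog.skip, Prog.pop 0,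
    Prog.loop 0 (some sep) (block [Prog.pop 0, pushWord 5 [one, one]]), Prog.pop 0,
    Prog.push 5 sep, emitCosts]

/-- The index of the literal `(v, b)`. -/
def literalIndex (v : ℕ) (b : Bool) : ℕ := b.toNat + 2 * v

/-- The region index `b + 2 * v` is produced while reading: one letter for a positive sign, and two
for each letter of the unary index. -/
theorem runs_emitLiteral (a o G h : List Letter) (b : Bool) (v n p N M : ℕ) (hn : n ≤ M)
    (hp : p ≤ M) (hv : v ≤ M) :
    Runs emitLiteral
      (store (bitLetter b :: unary v ++ a) [] (ones n) (ones p) (ones N) o G h)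
      (store a [] (ones n) (ones p) (ones (N + 1))
        ((itemWord n (literalIndex v b) p).reverse ++ o) G h) (28 * M + 16) := by
  have h1 : Runs (Prog.ite 0 (some one) (Prog.push 5 one) Prog.skip)
      (store (bitLetter b :: unary v ++ a) [] (ones n) (ones p) (ones N) o G h)
      (store (bitLetter b :: unary v ++ a) [] (ones n) (ones p) (ones N) (ones b.toNat ++ o) G h)
      2 := by
    cases b with
    | true => exact (Runs.ite_pos (by simp [bitLetter]) (Runs.push ..)).congr (by simp)
    | false => exact Runs.ite_neg (by simp [bitLetter]) (Runs.skip _)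
  have h2 := Runs.loop (r := 0) (o := some sep)
    (P := block [Prog.pop 0, pushWord 5 [one, one]]) (T := 5) v
    (fun i => store (ones (v - i) ++ sep :: a) [] (ones n) (ones p) (ones N)
      (ones (b.toNat + 2 * i) ++ o) G h)
    (fun i hi => by
      obtain ⟨k, hk⟩ : ∃ k, v - i = k + 1 := ⟨v - i - 1, by omega⟩
      simp [hk, List.replicate_succ])
    (by simp)
    (fun i hi => by
      obtain ⟨k, hk⟩ : ∃ k, v - i = k + 1 := ⟨v - i - 1, by omega⟩
      have hk' : v - (i + 1) = k := by omega
      refine (Runs.cons ((Runs.pop ..).congr (update_store_zero ..)) <|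
        Runs.cons ((runs_pushWord ..).congr (update_store_five ..)) <| Runs.nil ?_).mono (by simp)
      simp [hk, hk', List.replicate_succ, mul_add, ← add_assoc])
  refine (Runs.cons h1 <|
    Runs.cons (((Runs.pop ..).congr (update_store_zero ..)).congr ?_) <|
    Runs.cons h2 <|
    Runs.cons ((Runs.pop ..).congr (update_store_zero ..)) <|
    Runs.cons ((Runs.push ..).congr (update_store_five ..)) <|
    Runs.cons ((runs_emitCosts a (sep :: (ones (b.toNat + 2 * v) ++ o)) G h n p N M hn hp).congr_left ?_) <|
    Runs.nil ?_).mono ?_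
  · simp [unary]
  · simp
  · simp [itemWord, unary, literalIndex]
  · omega

/-- The code of a literal in a formula. -/
def literalWord {n : ℕ} (l : Fin n × Bool) : List Letter := bitLetter l.2 :: unary (l.1 : ℕ)

/-- The codes of the items that belong to the clauses in the list, the first clause being the part
with index `p`. -/
def clausesWord {n : ℕ} : List (Fin 3 → Fin n × Bool) → ℕ → List Letter
  | [], _ => []
  | C :: Cs, p =>
    ((List.finRange 3).flatMap fun j => itemWord n (literalIndex (C j).1 (C j).2) p) ++
      clausesWord Cs (p + 1)

/-- Read the clauses and append the corresponding items to the stack `5`. -/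
def emitClauses : Prog :=
  Prog.loop 0 none (block [emitLiteral, emitLiteral, emitLiteral, Prog.push 3 one])

/-- A common bound `M` on `n` and on all part indices makes every round cost the same, although the
index grows. -/
theorem runs_emitClauses {n : ℕ} (Cs : List (Fin 3 → Fin n × Bool)) (o G h : List Letter)
    (p N M : ℕ) (hn : n ≤ M) (hp : p + Cs.length ≤ M) :
    Runs emitClauses
      (store (Cs.flatMap fun C => (List.finRange 3).flatMap fun j => literalWord (C j))
        [] (ones n) (ones p) (ones N) o G h)
      (store [] [] (ones n) (ones (p + Cs.length)) (ones (N + 3 * Cs.length))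
        ((clausesWord Cs p).reverse ++ o) G h) (Cs.length * (84 * M + 51) + 1) := by
  induction Cs generalizing p N o with
  | nil => exact (Runs.loop_done (by simp)).congr (by simp [clausesWord]) |>.mono (by omega)
  | cons C Cs ih =>
    simp only [List.length_cons] at hp
    have hv (j) : ((C j).1 : ℕ) ≤ M := (C j).1.2.le.trans hn
    have lit (a o N j) := runs_emitLiteral a o G h (C j).2 (C j).1 n p N M hn (by omega) (hv j)
    obtain ⟨a, ha⟩ : ∃ a, a = Cs.flatMap fun C => (List.finRange 3).flatMap fun j =>
      literalWord (C j) := ⟨_, rfl⟩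
    have body := Runs.cons (lit (literalWord (C 1) ++ (literalWord (C 2) ++ a)) o N 0) <|
      Runs.cons (lit (literalWord (C 2) ++ a) _ (N + 1) 1) <|
      Runs.cons (lit a _ (N + 2) 2) <|
      Runs.cons ((Runs.push 3 one _).congr (update_store_three ..)) <| Runs.nil rfl
    refine (Runs.loop_step (by simp [List.finRange_succ, literalWord]) (body.congr_left ?_)
      ((ih ((itemWord n (literalIndex (C 2).1 (C 2).2) p).reverse ++
        ((itemWord n (literalIndex (C 1).1 (C 1).2) p).reverse ++
        ((itemWord n (literalIndex (C 0).1 (C 0).2) p).reverse ++ o)))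
        (p + 1) (N + 3) (by omega)).congr_left ?_ |>.congr ?_)).mono ?_
    · simp [ha, List.finRange_succ, literalWord]
    · simp [← ha, List.replicate_succ]
    · simp [clausesWord, List.finRange_succ, add_assoc, add_comm, mul_add]
    · simp only [List.length_cons]
      apply le_of_eq
      ring

/-- The codes of the two items of the variable `v`. -/
def variableWord (n v : ℕ) : List Letter :=
  itemWord n (literalIndex v false) v ++ itemWord n (literalIndex v true) v

/-- The codes of the budgets of the two regions of the variable `v`. -/
def budgetWord (v : ℕ) : List Letter :=
  (List.replicate v zero ++ [one, sep]) ++ (List.replicate v zero ++ [one, sep])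

/-- For all variables, append the two items to the stack `5` and the two budgets to the
stack `6`. -/
def emitVariables : Prog :=
  Prog.loop 7 none (block [Prog.pop 7,
    copy 3 [one, one] 5, Prog.push 5 sep, emitCosts,
    copy 3 [one, one] 5, Prog.push 5 one, Prog.push 5 sep, emitCosts,
    copy 3 [zero] 6, Prog.push 6 one, Prog.push 6 sep,
    copy 3 [zero] 6, Prog.push 6 one, Prog.push 6 sep,
    Prog.push 3 one])

/-- The counter on stack `3` serves as part index, as half of the region index, and as exponent of
the budget. It ends at `n`, the index of the first clause part. -/
theorem runs_emitVariables (a : List Letter) (n M : ℕ) (hn : n ≤ M) :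
    Runs emitVariables
      (store a [] (ones n) [] [] [] [] (ones n))
      (store a [] (ones n) (ones n) (ones (2 * n))
        ((List.range n).flatMap (variableWord n)).reverse
        ((List.range n).flatMap budgetWord).reverse [])
      (n * (100 * M + 40) + 1) := by
  have key := Runs.loop (r := 7) (o := none) (T := 100 * M + 39)
    (P := block [Prog.pop 7,
      copy 3 [one, one] 5, Prog.push 5 sep, emitCosts,
      copy 3 [one, one] 5, Prog.push 5 one, Prog.push 5 sep, emitCosts,
      copy 3 [zero] 6, Prog.push 6 one, Prog.push 6 sep,
      copy 3 [zero] 6, Prog.push 6 one, Prog.push 6 sep,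
      Prog.push 3 one]) n
    (fun v => store a [] (ones n) (ones v) (ones (2 * v))
        ((List.range v).flatMap (variableWord n)).reverse
        ((List.range v).flatMap budgetWord).reverse (ones (n - v)))
    (fun v hv => by
      have : n - v ≠ 0 := by omega
      simp [this])
    (by simp)
    (fun v hv => by
      have hv' : v ≤ M := by omega
      refine (Runs.cons ((Runs.pop ..).congr (update_store_seven ..)) <|
        Runs.cons ((runs_copy (k := v) _ _ ?_ ?_ ?_ ?_ ?_).congr (update_store_five ..)) <|
        Runs.cons ((Runs.push ..).congr (update_store_five ..)) <|
        Runs.cons (runs_emitCosts _ _ _ _ n v (2 * v) M hn hv') <|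
        Runs.cons ((runs_copy (k := v) _ _ ?_ ?_ ?_ ?_ ?_).congr (update_store_five ..)) <|
        Runs.cons ((Runs.push ..).congr (update_store_five ..)) <|
        Runs.cons ((Runs.push ..).congr (update_store_five ..)) <|
        Runs.cons (runs_emitCosts _ _ _ _ n v (2 * v + 1) M hn hv') <|
        Runs.cons ((runs_copy (k := v) _ _ ?_ ?_ ?_ ?_ ?_).congr (update_store_six ..)) <|
        Runs.cons ((Runs.push ..).congr (update_store_six ..)) <|
        Runs.cons ((Runs.push ..).congr (update_store_six ..)) <|
        Runs.cons ((runs_copy (k := v) _ _ ?_ ?_ ?_ ?_ ?_).congr (update_store_six ..)) <|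
        Runs.cons ((Runs.push ..).congr (update_store_six ..)) <|
        Runs.cons ((Runs.push ..).congr (update_store_six ..)) <|
        Runs.cons ((Runs.push ..).congr (update_store_three ..)) <|
        Runs.nil ?_).mono ?_
      all_goals first
        | rfl
        | simp; done
        | skip
      · simp [List.range_succ, variableWord, budgetWord, itemWord, reverse_unary, literalIndex,
          flatten_replicate_pair, List.replicate_succ, Nat.sub_sub, mul_comm, add_mul, Nat.add_comm 1]
      · simp only [List.length_cons, List.length_nil]
        omega)
  exact (key.congr_left (by simp)).congr (by simp)

/-- Assemble the instance on the stack `0`, emptying the other stacks. -/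
def assemble : Prog :=
  block [Prog.push 0 sep, copy 2 [one] 0, copy 3 [sep, one] 0, move 6 0, move 5 0,
    Prog.push 0 sep, move 3 0, Prog.push 0 sep, drain 2 [one, one] 0, Prog.push 0 sep, move 4 0]

/-- Stacks grow at the top, so the code is written back to front, starting with the threshold;
moving stacks `6` and `5` undoes their reversal. The counters for `n` and `L` are needed twice,
hence first copied and only later emptied. -/
theorem runs_assemble (n L N : ℕ) (o G : List Letter) :
    Runs assemble
      (store [] [] (ones n) (ones L) (ones N) o.reverse G.reverse [])
      (store (unary N ++ unary (n * 2) ++ unary L ++ o ++ G ++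
        (List.replicate L [one, sep]).flatten ++ (ones n ++ [sep])) [] [] [] [] [] [] [])
      (17 * n + 18 * L + 6 * N + 6 * o.length + 6 * G.length + 20) := by
  refine (Runs.cons ((Runs.push ..).congr (update_store_zero ..)) <|
    Runs.cons ((runs_copy (k := n) _ _ ?_ ?_ ?_ ?_ ?_).congr (update_store_zero ..)) <|
    Runs.cons ((runs_copy (k := L) _ _ ?_ ?_ ?_ ?_ ?_).congr (update_store_zero ..)) <|
    Runs.cons ((runs_move ?_ _).congr
      ((congrArg (Function.update · _ _) (update_store_six ..)).trans (update_store_zero ..))) <|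
    Runs.cons ((runs_move ?_ _).congr
      ((congrArg (Function.update · _ _) (update_store_five ..)).trans (update_store_zero ..))) <|
    Runs.cons ((Runs.push ..).congr (update_store_zero ..)) <|
    Runs.cons ((runs_move ?_ _).congr
      ((congrArg (Function.update · _ _) (update_store_three ..)).trans (update_store_zero ..))) <|
    Runs.cons ((Runs.push ..).congr (update_store_zero ..)) <|
    Runs.cons ((runs_drain ?_ _ _).congr
      ((congrArg (Function.update · _ _) (update_store_two ..)).trans (update_store_zero ..))) <|
    Runs.cons ((Runs.push ..).congr (update_store_zero ..)) <|
    Runs.cons ((runs_move ?_ _).congr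
      ((congrArg (Function.update · _ _) (update_store_four ..)).trans (update_store_zero ..))) <|
    Runs.nil ?_).mono ?_
  all_goals first
    | rfl
    | simp; done
    | skip
  · simp [unary, flatten_replicate_pair]
  · simp
    omega

/-- Read the number of variables into the stacks `2` and `7`. -/
def readSize : Prog :=
  block [Prog.loop 0 (some sep) (block [Prog.pop 0, Prog.push 2 one, Prog.push 7 one]), Prog.pop 0]

theorem runs_readSize (n : ℕ) (a : List Letter) :
    Runs readSize (store (unary n ++ a) [] [] [] [] [] [] [])
      (store a [] (ones n) [] [] [] [] (ones n)) (n * 5 + 3) := by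
  have key := Runs.loop (r := 0) (o := some sep) (T := 4)
    (P := block [Prog.pop 0, Prog.push 2 one, Prog.push 7 one]) n
    (fun i => store (ones (n - i) ++ sep :: a) [] (ones i) [] [] [] [] (ones i))
    (fun i hi => by
      obtain ⟨k, hk⟩ : ∃ k, n - i = k + 1 := ⟨n - i - 1, by omega⟩
      simp [hk, List.replicate_succ])
    (by simp)
    (fun i hi => by
      obtain ⟨k, hk⟩ : ∃ k, n - i = k + 1 := ⟨n - i - 1, by omega⟩
      have hk' : n - (i + 1) = k := by omega
      refine (Runs.cons ((Runs.pop ..).congr (update_store_zero ..)) <|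
        Runs.cons ((Runs.push ..).congr (update_store_two ..)) <|
        Runs.cons ((Runs.push ..).congr (update_store_seven ..)) <| Runs.nil ?_).mono (by simp)
      simp [hk, hk', List.replicate_succ])
  refine ((Runs.cons key <| Runs.cons ((Runs.pop ..).congr (update_store_zero ..)) <|
    Runs.nil ?_).congr_left ?_).mono ?_
  · simp
  · simp [unary]
  · omega

/-- The program that computes the reduction. -/
def reduction : Prog := block [readSize, emitVariables, emitClauses, assemble]

/-- The output of the reduction. -/
def reductionWord (φ : ThreeCNF) : List Letter :=
  unary (2 * φ.n + 3 * φ.clauses.length) ++ unary (φ.n * 2) ++ unary (φ.n + φ.clauses.length) ++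
    ((List.range φ.n).flatMap (variableWord φ.n) ++ clausesWord φ.clauses φ.n) ++
    (List.range φ.n).flatMap budgetWord ++
    (List.replicate (φ.n + φ.clauses.length) [one, sep]).flatten ++ (ones φ.n ++ [sep])

/-- The number of variables is written in unary and each clause takes at least one letter. Numbers
with `n` bits thus have length polynomial in the input. -/
theorem ThreeCNF.size_le_length_encode (φ : ThreeCNF) :
    φ.n + φ.clauses.length ≤ φ.encode.length := by
  have : φ.clauses.length ≤ (φ.clauses.flatMap fun C => (List.finRange 3).flatMap fun j =>
      bitLetter (C j).2 :: unary ((C j).1 : ℕ)).length := by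
    induction φ.clauses with
    | nil => simp
    | cons C Cs ih =>
      simp [List.finRange_succ] at ih ⊢
      omega
  rw [ThreeCNF.encode, List.length_append]
  simp only [unary, List.length_append, List.length_replicate] at this ⊢
  omega

theorem runs_reduction (φ : ThreeCNF) :
    Runs reduction (initStore φ.encode) (initStore (reductionWord φ))
      (2000 * (φ.encode.length + 1) ^ 2) := by
  obtain ⟨M, hM⟩ : ∃ M, M = φ.encode.length := ⟨_, rfl⟩
  have hsize : φ.n + φ.clauses.length ≤ M := hM ▸ φ.size_le_length_encode
  rw [initStore_eq_store, initStore_eq_store, ← hM]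
  have h1 := runs_readSize φ.n
    (φ.clauses.flatMap fun C => (List.finRange 3).flatMap fun j => literalWord (C j))
  have h2 := runs_emitVariables
    (φ.clauses.flatMap fun C => (List.finRange 3).flatMap fun j => literalWord (C j))
    φ.n M (by omega)
  have h3 := runs_emitClauses φ.clauses ((List.range φ.n).flatMap (variableWord φ.n)).reverse
    ((List.range φ.n).flatMap budgetWord).reverse [] φ.n (2 * φ.n) M (by omega) hsize
  have h4 := runs_assemble φ.n (φ.n + φ.clauses.length) (2 * φ.n + 3 * φ.clauses.length)
    ((List.range φ.n).flatMap (variableWord φ.n) ++ clausesWord φ.clauses φ.n)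
    ((List.range φ.n).flatMap budgetWord)
  -- Assembling costs time proportional to the words on stacks `5` and `6`. Their lengths are
  -- bounded by the time spent writing them.
  have l2 := h2.length_le 6
  have l3 := (h2.seq h3).length_le 5
  simp only [store_six, store_five, List.length_append, List.length_reverse,
    List.length_nil] at l2 l3
  refine (Runs.cons h1 <| Runs.cons h2 <| Runs.cons h3 <|
    Runs.cons (h4.congr_left ?_) <| Runs.nil ?_).mono ?_
  · simp
  · rfl
  · have e1 : φ.n * (100 * M + 40) ≤ M * (100 * M + 40) := Nat.mul_le_mul_right _ (by omega)
    have e2 : φ.clauses.length * (84 * M + 51) ≤ M * (84 * M + 51) :=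
      Nat.mul_le_mul_right _ (by omega)
    simp only [List.length_append]
    ring_nf at e1 e2 l2 l3 ⊢
    nlinarith

/-- The output is no longer than the input plus the number of steps; raising 2000 to 2001 absorbs
the input length. -/
theorem length_reductionWord_le (φ : ThreeCNF) :
    (reductionWord φ).length ≤ 2001 * (φ.encode.length + 1) ^ 2 := by
  have := (runs_reduction φ).length_le 0
  simp only [initStore, Function.update_self] at this
  nlinarith

/-! ### The instance that belongs to a formula -/

/-- With the least significant bit first, numbers `2 ^ n - 1` and `2 ^ v` are written by copying a
unary counter, without any arithmetic. -/
theorem binary_two_pow_sub_one (n : ℕ) : binary (2 ^ n - 1) = ones n ++ [sep] := by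
  have : (2 ^ n - 1).bits = List.replicate n true := by
    induction n with
    | zero => simp
    | succ n ih =>
      have e : 2 ^ (n + 1) - 1 = 2 * (2 ^ n - 1) + 1 := by
        have := Nat.one_le_two_pow (n := n)
        rw [pow_succ]
        omega
      rw [e, Nat.bit1_bits, ih, List.replicate_succ]
  simp [binary, this, bitLetter]

theorem binary_two_pow (n : ℕ) : binary (2 ^ n) = List.replicate n zero ++ [one, sep] := by
  have : (2 ^ n).bits = List.replicate n false ++ [true] := by
    induction n with
    | zero => simp
    | succ n ih =>
      rw [pow_succ', Nat.bit0_bits _ (by positivity), ih, List.replicate_succ, List.cons_append]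
  simp [binary, this, bitLetter]

theorem flatMap_finRange {α : Type*} (n : ℕ) (f : ℕ → List α) :
    (List.finRange n).flatMap (fun i : Fin n => f i) = (List.range n).flatMap f := by
  rw [← List.map_coe_finRange_eq_range, List.flatMap_map]

theorem flatMap_range_mul_two {α : Type*} (n : ℕ) (f : ℕ → List α) :
    (List.range (n * 2)).flatMap f =
      (List.range n).flatMap fun v => f (2 * v) ++ f (2 * v + 1) := by
  induction n with
  | zero => rfl
  | succ n ih => simp [Nat.succ_mul, List.range_succ, ih, mul_comm]

namespace ThreeCNF

variable (φ : ThreeCNF)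

/-- The items: one for every literal and one for every place in a clause. -/
abbrev Item : Type := (Fin φ.n × Bool) ⊕ (Fin φ.clauses.length × Fin 3)

/-- All items in the order in which they are numbered. -/
def items : List φ.Item :=
  ((List.finRange φ.n).flatMap fun v => [Sum.inl (v, false), Sum.inl (v, true)]) ++
    (List.finRange φ.clauses.length).flatMap fun c => (List.finRange 3).map fun j => Sum.inr (c, j)

theorem length_items : φ.items.length = 2 * φ.n + 3 * φ.clauses.length := by
  simp [items, mul_comm]

theorem mem_items (i : φ.Item) : i ∈ φ.items := by
  rcases i with ⟨v, b⟩ | ⟨c, j⟩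
  · cases b <;> simp [items]
  · simp [items]

/-- A list that contains every item and is as long as the number of items cannot repeat one. -/
theorem nodup_items : φ.items.Nodup := by
  have h : φ.items.toFinset = Finset.univ := by
    ext i
    simp [mem_items]
  have h' : φ.items.toFinset.card = φ.items.length := by
    rw [h, length_items]
    simp [mul_comm]
  exact (Multiset.toFinset_card_eq_card_iff_nodup (m := (φ.items : Multiset φ.Item))).1 h'

/-- The numbering of the items. -/
def itemEquiv : Fin φ.items.length ≃ φ.Item :=
  φ.nodup_items.getEquivOfForallMemList φ.items φ.mem_items

/-- The numbering of the literals. -/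
def literalEquiv : Fin φ.n × Bool ≃ Fin (φ.n * 2) :=
  ((Equiv.refl _).prodCongr finTwoEquiv.symm).trans finProdFinEquiv

theorem literalEquiv_val (l : Fin φ.n × Bool) :
    (φ.literalEquiv l : ℕ) = literalIndex l.1 l.2 := by
  rcases l with ⟨v, _ | _⟩ <;> simp [literalEquiv, literalIndex, finTwoEquiv]

theorem literalEquiv_symm_fst (j : Fin (φ.n * 2)) :
    ((φ.literalEquiv.symm j).1 : ℕ) = j / 2 := by
  simp [literalEquiv, finProdFinEquiv]

/-- The literal of an item. -/
def literal : φ.Item → Fin φ.n × Bool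
  | Sum.inl l => l
  | Sum.inr (c, j) => φ.clauses.get c j

/-- The part of an item: a variable or a clause. -/
def block : φ.Item → Fin φ.n ⊕ Fin φ.clauses.length
  | Sum.inl (v, _) => Sum.inl v
  | Sum.inr (c, _) => Sum.inr c

/-- The instance of the representative selection problem that belongs to the formula. There is one
region for every literal, and one part for every variable and every clause. -/
abbrev toRepSel : RepSelInstance where
  n := φ.items.length
  K := φ.n * 2
  L := φ.n + φ.clauses.length
  region i := φ.literalEquiv (φ.literal (φ.itemEquiv i))
  region_surjective j := ⟨φ.itemEquiv.symm (Sum.inl (φ.literalEquiv.symm j)), by simp [literal]⟩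
  part i := finSumFinEquiv (φ.block (φ.itemEquiv i))
  part_surjective l := by
    obtain ⟨l, rfl⟩ := finSumFinEquiv.surjective l
    rcases l with v | c
    · exact ⟨φ.itemEquiv.symm (Sum.inl (v, true)), by simp [block]⟩
    · exact ⟨φ.itemEquiv.symm (Sum.inr (c, 0)), by simp [block]⟩
  p _ := 1
  c _ := 0
  d _ := 2 ^ φ.n - 1
  Γ j := 2 ^ ((φ.literalEquiv.symm j).1 : ℕ)

/-- Within a part, an item is determined by its sign or by its place in the clause, which is a label
in `Fin 3`. -/
theorem card_partSet_toRepSel_le (l : Fin φ.toRepSel.L) : (φ.toRepSel.partSet l).card ≤ 3 := by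
  let f : φ.Item → Fin 3
    | Sum.inl (_, b) => if b then 1 else 0
    | Sum.inr (_, j) => j
  have : Set.InjOn (fun i : Fin φ.toRepSel.n => f (φ.itemEquiv i)) (φ.toRepSel.partSet l) := by
    intro i hi i' hi' h
    change f (φ.itemEquiv i) = f (φ.itemEquiv i') at h
    have hb := finSumFinEquiv.injective
      ((Finset.mem_filter.1 hi).2.trans (Finset.mem_filter.1 hi').2.symm)
    apply φ.itemEquiv.injective
    revert hb h
    generalize φ.itemEquiv i = a
    generalize φ.itemEquiv i' = a'
    rcases a with ⟨v, _ | _⟩ | ⟨c, j⟩ <;> rcases a' with ⟨v', _ | _⟩ | ⟨c', j'⟩ <;>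
      simp +contextual [f, block]
  simpa using Finset.card_le_card_of_injOn _ (fun i _ => Finset.mem_univ _) this

theorem clausesWord_eq {n : ℕ} (Cs : List (Fin 3 → Fin n × Bool)) (p : ℕ) :
    clausesWord Cs p = (List.finRange Cs.length).flatMap fun c =>
      (List.finRange 3).flatMap fun j =>
        itemWord n (literalIndex (Cs.get c j).1 (Cs.get c j).2) (p + c) := by
  induction Cs generalizing p with
  | nil => rfl
  | cons C Cs ih =>
    rw [clausesWord, ih]
    simp only [List.length_cons]
    rw [List.finRange_succ (n := Cs.length), List.flatMap_cons, List.flatMap_map]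
    simp [add_assoc, add_comm 1]
    rfl

theorem encode_toRepSel : φ.toRepSel.encode (2 ^ φ.n - 1) = reductionWord φ := by
  have h1 : ((List.finRange φ.items.length).flatMap fun i =>
      unary (φ.literalEquiv (φ.literal (φ.itemEquiv i)) : ℕ) ++
        unary (finSumFinEquiv (φ.block (φ.itemEquiv i)) : ℕ) ++ binary 0 ++ binary (2 ^ φ.n - 1)) =
      (List.range φ.n).flatMap (variableWord φ.n) ++ clausesWord φ.clauses φ.n := by
    -- Items are numbered by their position in `items`, so running through the indices is running
    -- through that list, whose two halves are the variable and clause items.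
    have : ((List.finRange φ.items.length).flatMap fun i =>
      unary (φ.literalEquiv (φ.literal (φ.itemEquiv i)) : ℕ) ++
        unary (finSumFinEquiv (φ.block (φ.itemEquiv i)) : ℕ) ++ binary 0 ++
          binary (2 ^ φ.n - 1)) = ((List.finRange φ.items.length).map φ.items.get).flatMap fun i =>
        itemWord φ.n (literalIndex (φ.literal i).1 (φ.literal i).2)
          (finSumFinEquiv (φ.block i) : ℕ) := by
      rw [List.flatMap_map]
      congr 1
      funext i
      rw [binary_two_pow_sub_one]
      simp [itemWord, literalEquiv_val, binary, itemEquiv]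
    rw [this, List.map_get_finRange, items, List.flatMap_append, List.flatMap_assoc,
      List.flatMap_assoc, ← flatMap_finRange, clausesWord_eq]
    congr 1
    refine congrArg (List.flatMap · _) (funext fun v => ?_)
    simp [variableWord, literal, block]
  have h2 : ((List.finRange (φ.n * 2)).flatMap fun j =>
      binary (2 ^ ((φ.literalEquiv.symm j).1 : ℕ))) = (List.range φ.n).flatMap budgetWord := by
    simp only [literalEquiv_symm_fst]
    rw [flatMap_finRange (φ.n * 2) fun j => binary (2 ^ (j / 2)), flatMap_range_mul_two]
    congr 1
    funext v
    have : (2 * v + 1) / 2 = v := by omega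
    simp [budgetWord, binary_two_pow, this]
  have h3 : ((List.finRange (φ.n + φ.clauses.length)).flatMap fun _ => binary 1) =
      (List.replicate (φ.n + φ.clauses.length) [one, sep]).flatten := by
    simp [List.flatMap_def, binary, bitLetter]
  simp only [RepSelInstance.encode, toRepSel, reductionWord, h1, h2, h3]
  rw [length_items, binary_two_pow_sub_one]

end ThreeCNF

/-! ### Correctness of the reduction -/

theorem sum_two_pow (n : ℕ) : ∑ v : Fin n, (2 : ℝ) ^ (v : ℕ) = ((2 ^ n - 1 : ℕ) : ℝ) := by
  rw [Fin.sum_univ_eq_sum_range (fun v => (2 : ℝ) ^ v), geom_sum_eq (by norm_num),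
    Nat.cast_sub Nat.one_le_two_pow]
  norm_num

/-- If both values are used for some index, then the weights of the used pairs exceed
the sum of all weights. -/
theorem not_and_of_sum_le {ι : Type*} [Fintype ι] (w : ι → ℝ) (hw : ∀ v, 0 < w v)
    (u : ι × Bool → Prop) [DecidablePred u] (hu : ∀ v, ∃ b, u (v, b))
    (h : ∑ l, (if u l then w l.1 else 0) ≤ ∑ v, w v) (v : ι) :
    ¬ (u (v, false) ∧ u (v, true)) := by
  rintro ⟨h0, h1⟩
  refine h.not_gt ?_
  rw [Fintype.sum_prod_type]
  -- Every index contributes its weight at least once, and the index `v` twice.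
  refine Finset.sum_lt_sum (fun v _ => ?_) ⟨v, Finset.mem_univ _, ?_⟩
  · rw [Fintype.sum_bool]
    have := (hw v).le
    obtain ⟨_ | _, hb⟩ := hu v
    · rw [if_pos hb]; split_ifs <;> linarith
    · rw [if_pos hb]; split_ifs <;> linarith
  · rw [Fintype.sum_bool, if_pos h0, if_pos h1]
    linarith [hw v]

namespace RepSelInstance

variable (I : RepSelInstance)

/-- Boundedness is what lets a single scenario bound `robustCost` from below through `le_csSup`. -/
theorem bddAbove_cost {x : Fin I.n → ℝ} (hx : x ∈ I.feasible) :
    BddAbove ((fun cost : Fin I.n → ℝ => ∑ i, cost i * x i) '' I.uncertaintySet) := by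
  refine ⟨∑ i, ((I.c i : ℝ) + I.d i), ?_⟩
  rintro _ ⟨cost, ⟨δ, hcost, hδ, -⟩, rfl⟩
  refine Finset.sum_le_sum fun i _ => ?_
  have h0 := (hδ i).1
  have h1 := (hδ i).2
  have hc : (0 : ℝ) ≤ I.c i := Nat.cast_nonneg _
  rcases hx.1 i with h | h <;> rw [h, hcost] <;> linarith

/-- Some item is selected from every part with `p l ≠ 0`. -/
theorem exists_eq_one {x : Fin I.n → ℝ} (hx : x ∈ I.feasible) {l : Fin I.L} (hl : I.p l ≠ 0) :
    ∃ i, I.part i = l ∧ x i = 1 := by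
  by_contra! h
  have h0 : ∑ i ∈ I.partSet l, x i = 0 := Finset.sum_eq_zero fun i hi =>
    (hx.1 i).resolve_right (h i (Finset.mem_filter.1 hi).2)
  rw [hx.2 l] at h0
  exact hl (by exact_mod_cast h0)

end RepSelInstance

namespace ThreeCNF

variable (φ : ThreeCNF)

/-- Select a true literal from every part. Only regions of true literals matter to the cost, and
their budgets add up to the threshold because each variable has exactly one true literal. -/
theorem hasRobustCostAtMost_of_satisfiable (h : φ.Satisfiable) :
    φ.toRepSel.HasRobustCostAtMost (2 ^ φ.n - 1) := by
  obtain ⟨a, ha⟩ := h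
  have ha' : ∀ c : Fin φ.clauses.length, ∃ j, a (φ.clauses.get c j).1 = (φ.clauses.get c j).2 :=
    fun c => ha _ (List.get_mem _ _)
  choose J hJ using ha'
  let T : Fin φ.n × Bool → Prop := fun l => a l.1 = l.2
  let r : Fin φ.n ⊕ Fin φ.clauses.length → φ.Item
    | Sum.inl v => Sum.inl (v, a v)
    | Sum.inr c => Sum.inr (c, J c)
  have hr (l) : φ.block (r l) = l := by rcases l with v | c <;> rfl
  have hT (l) : T (φ.literal (r l)) := by
    rcases l with v | c
    · rfl
    · exact hJ c
  let x : Fin φ.toRepSel.n → ℝ := fun i =>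
    if φ.itemEquiv i = r (φ.block (φ.itemEquiv i)) then 1 else 0
  have hxT (i : Fin φ.toRepSel.n) (hi : x i ≠ 0) : T (φ.literal (φ.itemEquiv i)) := by
    have : φ.itemEquiv i = r (φ.block (φ.itemEquiv i)) := by
      by_contra h
      exact hi (if_neg h)
    rw [this]
    exact hT _
  have hx01 (i) : x i = 0 ∨ x i = 1 := by
    by_cases h : φ.itemEquiv i = r (φ.block (φ.itemEquiv i))
    · exact Or.inr (if_pos h)
    · exact Or.inl (if_neg h)
  refine ⟨x, ⟨hx01, fun l => ?_⟩, ?_⟩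
  · obtain ⟨l, rfl⟩ := finSumFinEquiv.surjective l
    have hi₀ : x (φ.itemEquiv.symm (r l)) = 1 := if_pos (by simp [hr])
    rw [Finset.sum_eq_single_of_mem (φ.itemEquiv.symm (r l)), hi₀]
    · simp
    · exact Finset.mem_filter.2 ⟨Finset.mem_univ _, by simp [hr]⟩
    · intro i hi hne
      have hb : φ.block (φ.itemEquiv i) = l := finSumFinEquiv.injective (Finset.mem_filter.1 hi).2
      refine if_neg fun h => hne ?_
      rw [hb] at h
      rw [← h]
      exact (φ.itemEquiv.symm_apply_apply i).symm
  -- The scenario without deviations shows that the set is nonempty.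
  · refine csSup_le (Set.Nonempty.image _ ⟨fun i => (φ.toRepSel.c i : ℝ), fun _ => 0,
      by simp, fun i => ⟨le_rfl, Nat.cast_nonneg _⟩, by simp⟩) ?_
    rintro _ ⟨cost, ⟨δ, hcost, hδ, hΓ⟩, rfl⟩
    -- Passing from the selected items to all items with a true literal gives a condition that is
    -- constant on each region.
    calc ∑ i, cost i * x i
        ≤ ∑ i, if T (φ.literal (φ.itemEquiv i)) then δ i else 0 := by
          refine Finset.sum_le_sum fun i _ => ?_
          have hc : cost i = δ i := by rw [hcost]; simp
          have h0 := (hδ i).1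
          rcases hx01 i with h | h
          · rw [h, mul_zero]
            split_ifs <;> linarith
          · rw [h, if_pos (hxT i (by rw [h]; norm_num)), hc, mul_one]
      _ = ∑ j, ∑ i ∈ φ.toRepSel.regionSet j, if T (φ.literal (φ.itemEquiv i)) then δ i else 0 :=
          (Finset.sum_fiberwise _ _ _).symm
      _ ≤ ∑ j : Fin (φ.n * 2), if T (φ.literalEquiv.symm j)
            then (2 : ℝ) ^ ((φ.literalEquiv.symm j).1 : ℕ) else 0 := by
          refine Finset.sum_le_sum fun j _ => ?_
          have : ∀ i ∈ φ.toRepSel.regionSet j, φ.literal (φ.itemEquiv i) = φ.literalEquiv.symm j := by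
            intro i hi
            rw [Equiv.eq_symm_apply]
            exact (Finset.mem_filter.1 hi).2
          rw [Finset.sum_congr rfl fun i hi => by rw [this i hi]]
          split_ifs
          · simpa [toRepSel] using hΓ j
          · simp
      _ = ∑ l : Fin φ.n × Bool, if T l then (2 : ℝ) ^ (l.1 : ℕ) else 0 :=
          Equiv.sum_comp φ.literalEquiv.symm fun l => if T l then (2 : ℝ) ^ (l.1 : ℕ) else 0
      _ = ∑ v : Fin φ.n, (2 : ℝ) ^ (v : ℕ) := by
          rw [Fintype.sum_prod_type]
          refine Finset.sum_congr rfl fun v _ => ?_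
          simp [T]
      _ = ((2 ^ φ.n - 1 : ℕ) : ℝ) := sum_two_pow _

/-- The scenario that puts the budget of each used literal on one selected item shows that the
weights of the used literals sum to at most the threshold. Hence no variable has both literals used,
and making a variable true when its positive literal is used satisfies every used literal. -/
theorem satisfiable_of_hasRobustCostAtMost
    (h : φ.toRepSel.HasRobustCostAtMost (2 ^ φ.n - 1)) : φ.Satisfiable := by
  obtain ⟨x, hx, hcost⟩ := h
  let u : Fin φ.n × Bool → Prop := fun l =>
    ∃ i : Fin φ.toRepSel.n, φ.literal (φ.itemEquiv i) = l ∧ x i = 1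
  have : DecidablePred u := Classical.decPred u
  have hsel (l) : ∃ i : Fin φ.toRepSel.n, φ.block (φ.itemEquiv i) = l ∧ x i = 1 := by
    obtain ⟨i, hi, hxi⟩ := φ.toRepSel.exists_eq_one hx (l := finSumFinEquiv l) one_ne_zero
    exact ⟨i, finSumFinEquiv.injective hi, hxi⟩
  have hu (v) : ∃ b, u (v, b) := by
    obtain ⟨i, hi, hxi⟩ := hsel (Sum.inl v)
    refine ⟨(φ.literal (φ.itemEquiv i)).2, i, ?_, hxi⟩
    revert hi
    generalize φ.itemEquiv i = a
    rcases a with ⟨v', b⟩ | ⟨c, j⟩ <;> simp [block, literal]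
  have hw : ∃ w : Fin φ.n × Bool → Fin φ.toRepSel.n,
      ∀ l, u l → φ.literal (φ.itemEquiv (w l)) = l ∧ x (w l) = 1 := by
    -- The default item is irrelevant: regions of unused literals are later dropped by
    -- nonnegativity.
    refine ⟨fun l => if h : u l then h.choose else φ.itemEquiv.symm (Sum.inl l), fun l h => ?_⟩
    simp only [dif_pos h]
    exact h.choose_spec
  obtain ⟨w, hw⟩ := hw
  let δ : Fin φ.toRepSel.n → ℝ := fun i =>
    if i = w (φ.literal (φ.itemEquiv i)) then 2 ^ ((φ.literal (φ.itemEquiv i)).1 : ℕ) else 0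
  have hδ0 (i) : 0 ≤ δ i := by
    simp only [δ]
    split_ifs <;> positivity
  have hreg {i : Fin φ.toRepSel.n} {l} (hi : i ∈ φ.toRepSel.regionSet (φ.literalEquiv l)) :
      φ.literal (φ.itemEquiv i) = l := φ.literalEquiv.injective (Finset.mem_filter.1 hi).2
  have hδ : δ ∈ φ.toRepSel.uncertaintySet := by
    refine ⟨δ, by simp [toRepSel], fun i => ⟨hδ0 i, ?_⟩, fun j => ?_⟩
    -- As `v < n`, one item can absorb the whole budget `2 ^ v`.
    · have h1 : (2 : ℝ) ^ ((φ.literal (φ.itemEquiv i)).1 : ℕ) ≤ ((2 ^ φ.n - 1 : ℕ) : ℝ) := by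
        have := Nat.pow_lt_pow_right (a := 2) (by norm_num) (φ.literal (φ.itemEquiv i)).1.2
        exact_mod_cast Nat.le_sub_one_of_lt this
      simp only [δ]
      split_ifs
      · exact h1
      · exact Nat.cast_nonneg _
    · obtain ⟨l, rfl⟩ := φ.literalEquiv.surjective j
      calc ∑ i ∈ φ.toRepSel.regionSet (φ.literalEquiv l), δ i
          = ∑ i ∈ φ.toRepSel.regionSet (φ.literalEquiv l),
              if i = w l then (2 : ℝ) ^ (l.1 : ℕ) else 0 :=
            Finset.sum_congr rfl fun i hi => by simp only [δ, hreg hi]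
        _ ≤ (2 : ℝ) ^ (l.1 : ℕ) := by
            rw [Finset.sum_ite_eq']
            split_ifs
            · exact le_rfl
            · positivity
        _ = (φ.toRepSel.Γ (φ.literalEquiv l) : ℝ) := by simp
  have hle : ∑ l, (if u l then (2 : ℝ) ^ (l.1 : ℕ) else 0) ≤ ∑ v : Fin φ.n, (2 : ℝ) ^ (v : ℕ) := by
    rw [sum_two_pow]
    refine le_trans ?_ ((le_csSup (φ.toRepSel.bddAbove_cost hx) ⟨δ, hδ, rfl⟩).trans hcost)
    have hx0 (i) : 0 ≤ x i := by rcases hx.1 i with h | h <;> rw [h]; norm_num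
    calc ∑ l, (if u l then (2 : ℝ) ^ (l.1 : ℕ) else 0)
        ≤ ∑ l, ∑ i ∈ φ.toRepSel.regionSet (φ.literalEquiv l), δ i * x i := by
          refine Finset.sum_le_sum fun l _ => ?_
          split_ifs with hl
          · obtain ⟨h1, h2⟩ := hw l hl
            have hmem : w l ∈ φ.toRepSel.regionSet (φ.literalEquiv l) :=
              Finset.mem_filter.2 ⟨Finset.mem_univ _, congrArg φ.literalEquiv h1⟩
            refine le_trans (le_of_eq ?_) (Finset.single_le_sum (f := fun i => δ i * x i)
              (fun i _ => mul_nonneg (hδ0 i) (hx0 i)) hmem)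
            simp [δ, h1, h2]
          · exact Finset.sum_nonneg fun i _ => mul_nonneg (hδ0 i) (hx0 i)
      _ = ∑ j, ∑ i ∈ φ.toRepSel.regionSet j, δ i * x i :=
          Equiv.sum_comp φ.literalEquiv fun j => ∑ i ∈ φ.toRepSel.regionSet j, δ i * x i
      _ = ∑ i, δ i * x i := Finset.sum_fiberwise _ _ _
  have hnot := not_and_of_sum_le (fun v : Fin φ.n => (2 : ℝ) ^ (v : ℕ)) (fun v => by positivity)
    u hu hle
  refine ⟨fun v => decide (u (v, true)), fun C hC => ?_⟩
  obtain ⟨c, rfl⟩ := List.mem_iff_get.1 hC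
  obtain ⟨i, hi, hxi⟩ := hsel (Sum.inr c)
  have : ∃ j, φ.literal (φ.itemEquiv i) = φ.clauses.get c j := by
    revert hi
    generalize φ.itemEquiv i = a
    rcases a with ⟨v', b⟩ | ⟨c', j⟩
    · simp [block]
    · intro hi
      obtain rfl : c' = c := by simpa [block] using hi
      exact ⟨j, rfl⟩
  obtain ⟨j, hj⟩ := this
  have huj : u (φ.clauses.get c j) := ⟨i, hj, hxi⟩
  refine ⟨j, ?_⟩
  revert huj
  generalize φ.clauses.get c j = l
  obtain ⟨v, _ | _⟩ := l
  · intro h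
    simpa using fun h' => hnot v ⟨h, h'⟩
  · intro h
    simpa using h

theorem hasRobustCostAtMost_iff_satisfiable :
    φ.toRepSel.HasRobustCostAtMost (2 ^ φ.n - 1) ↔ φ.Satisfiable :=
  ⟨φ.satisfiable_of_hasRobustCostAtMost, φ.hasRobustCostAtMost_of_satisfiable⟩

end ThreeCNF

/-! ### The lower bound -/

/-- For large `n`, the exponent at `2 * n` is at most `(δ / 2) * (2 * n) = δ * n`; the finitely many
remaining values are absorbed by `C`. -/
theorem exists_rpow_le_of_isLittleO {f : ℕ → ℝ} (hf : f =o[Filter.atTop] (fun K : ℕ => (K : ℝ)))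
    {δ : ℝ} (hδ : 0 < δ) : ∃ C : ℕ, ∀ n : ℕ, (2 : ℝ) ^ f (n * 2) ≤ C * (2 : ℝ) ^ (δ * n) := by
  have h := hf.bound (half_pos hδ)
  obtain ⟨N, hN⟩ := Filter.eventually_atTop.1 h
  obtain ⟨C, hC⟩ := exists_nat_ge (1 + ∑ n ∈ Finset.range N, (2 : ℝ) ^ f (n * 2))
  have hpos (m : ℕ) : (0 : ℝ) < 2 ^ f m := by positivity
  have hsum : 0 ≤ ∑ n ∈ Finset.range N, (2 : ℝ) ^ f (n * 2) :=
    Finset.sum_nonneg fun n _ => (hpos _).le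
  refine ⟨C, fun n => ?_⟩
  have h1 : 1 ≤ (2 : ℝ) ^ (δ * n) := Real.one_le_rpow (by norm_num) (by positivity)
  by_cases hn : n < N
  · have := Finset.single_le_sum (f := fun n => (2 : ℝ) ^ f (n * 2)) (fun n _ => (hpos _).le)
      (Finset.mem_range.2 hn)
    nlinarith
  · have h2 := (le_abs_self _).trans (hN (n * 2) (by omega))
    have h3 : (2 : ℝ) ^ f (n * 2) ≤ 2 ^ (δ * n) := by
      refine Real.rpow_le_rpow_of_exponent_le (by norm_num) (h2.trans (le_of_eq ?_))
      rw [Real.norm_of_nonneg (by positivity)]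
      push_cast
      ring
    nlinarith

theorem eval_mono (q : Polynomial ℕ) {m n : ℕ} (h : m ≤ n) : q.eval m ≤ q.eval n := by
  rw [Polynomial.eval_eq_sum, Polynomial.eval_eq_sum]
  exact Finset.sum_le_sum fun i _ => Nat.mul_le_mul_left _ (Nat.pow_le_pow_left h i)

end LocBudget

/-- Assuming the exponential time hypothesis, no algorithm decides the robust representative
selection problem with locally budgeted uncertainty in time `O*(2 ^ o(K))`, not even on the
instances in which all parts have at most three items and `p l = 1` for all `l`. -/
theorem mainTheorem4 (hETH : LocBudget.ExponentialTimeHypothesis) :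
    ¬ ∃ f : ℕ → ℝ, f =o[Filter.atTop] (fun K : ℕ => (K : ℝ)) ∧
      LocBudget.DecidableInTimeStar
        {y : LocBudget.RepSelInstance × ℕ |
          ∀ l : Fin y.1.L, (y.1.partSet l).card ≤ 3 ∧ y.1.p l = 1}
        (fun y => y.1.encode y.2)
        (fun y => y.1.HasRobustCostAtMost y.2)
        (fun y => y.1.K)
        f := by
  rintro ⟨f, hf, P, q, hP⟩
  obtain ⟨δ, hδ, hno⟩ := hETH
  obtain ⟨C, hC⟩ := LocBudget.exists_rpow_le_of_isLittleO hf hδ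
  let S : Polynomial ℕ := (Polynomial.X + 1) ^ 2
  -- The first summand pays for the reduction. The second pays for `P`, with `q` evaluated at a
  -- bound on the output length and `C` from comparing the exponentials.
  refine hno ⟨LocBudget.Prog.seq LocBudget.reduction P,
    2000 * S + Polynomial.C C * q.comp (2001 * S), fun φ _ => ?_⟩
  obtain ⟨t, s, hexec, ht, hs⟩ := hP (φ.toRepSel, 2 ^ φ.n - 1)
    fun l => ⟨φ.card_partSet_toRepSel_le l, rfl⟩
  obtain ⟨t', ht', hred⟩ := LocBudget.runs_reduction φ
  -- The reduction leaves exactly the initial store of `P` on this instance, with all scratch stacks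
  -- empty, so the two runs compose.
  simp only [φ.encode_toRepSel] at hexec ht hs
  refine ⟨t' + t, s, LocBudget.Exec.seq hred hexec, ?_,
    hs.trans φ.hasRobustCostAtMost_iff_satisfiable⟩
  have h1 : 1 ≤ (2 : ℝ) ^ (δ * φ.n) := Real.one_le_rpow (by norm_num) (by positivity)
  have hq := LocBudget.eval_mono q (LocBudget.length_reductionWord_le φ)
  have hev : (2000 * S + Polynomial.C C * q.comp (2001 * S)).eval φ.encode.length =
      2000 * (φ.encode.length + 1) ^ 2 +
        C * q.eval (2001 * (φ.encode.length + 1) ^ 2) := by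
    simp [S]
  simp only [hev]
  push_cast
  have ht1 : (t' : ℝ) ≤ 2000 * ((φ.encode.length : ℝ) + 1) ^ 2 := by exact_mod_cast ht'
  calc (t' : ℝ) + t
      ≤ 2000 * ((φ.encode.length : ℝ) + 1) ^ 2 * 2 ^ (δ * φ.n) +
          q.eval (2001 * (φ.encode.length + 1) ^ 2) * (C * 2 ^ (δ * φ.n)) := by
        refine add_le_add (ht1.trans (le_mul_of_one_le_right (by positivity) h1)) (ht.trans ?_)
        exact mul_le_mul (by exact_mod_cast hq) (hC φ.n) (by positivity) (by positivity)
    _ = _ := by ring
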